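/- For sequences $(a_n)_{n\ge 0}$ and $(b_n)_{n\ge 1}$ of real numbers let $$\mathrm{CF}[a_n,b_n]=a_0+\cfrac{b_1}{a_1+\cfrac{b_2}{a_2+\ddots}}$$ denote the limit, as $n\to\infty$, of the finite continued fractions $$a_0+\cfrac{b_1}{a_1+\cfrac{b_2}{\ddots+\cfrac{b_n}{a_n}}}.$$ Then, for $a_n=3n^2+7n+4$ and $b_n=-2n^2(n+1)^2$, all these finite continued fractions are well defined (no division by zero occurs in them), the limit exists, and $$\frac{1}{1-\log 2}=\mathrm{CF}\left[3n^2+7n+4,\,-2n^2(n+1)^2\right].$$ -/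

import Mathlib

open Filter Topology

namespace PolyCF

/-- The continued fraction `CF[a_n, b_n] = a₀ + b₁ / (a₁ + b₂ / (a₂ + ⋯))` as a (formal, infinite)
generalized continued fraction: head term `a 0`, partial numerators `b 1, b 2, …` and partial
denominators `a 1, a 2, …`. The value `b 0` is not used. -/
def CF (a b : ℕ → ℝ) : GenContFract ℝ :=
  ⟨a 0, Stream'.Seq.ofStream fun n => ⟨b (n + 1), a (n + 1)⟩⟩

/-- The finite continued fraction
`a_k + b_{k+1} / (a_{k+1} + b_{k+2} / (a_{k+2} + ⋯ + b_{k+n} / a_{k+n}))`,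
evaluated literally, from the innermost quotient outwards. -/
noncomputable def cfSegment (a b : ℕ → ℝ) (k n : ℕ) : ℝ :=
  (CF (fun i => a (k + i)) (fun i => b (k + i))).convs' n

/-- `CF[a_n, b_n] = L`: no truncation
`a_0 + b_1 / (a_1 + ⋯ + b_n / a_n)` involves a division by zero (the divisors occurring in the
truncations are exactly the segments that start at an index `≥ 1`), and the truncations converge
to `L` as `n → ∞`. -/
def HasValue (a b : ℕ → ℝ) (L : ℝ) : Prop :=
  (∀ k n : ℕ, cfSegment a b (k + 1) n ≠ 0) ∧
    Tendsto (fun n : ℕ => (CF a b).convs' n) atTop (𝓝 L)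

end PolyCF

namespace PolyCF

open Finset

/-! This is an Euler-type continued fraction: each truncation is the reciprocal of a partial sum of
a positive series with sum `1 - log 2`. Segments starting at a positive index are positive multiples
of ratios of block sums of that series, so no divisor vanishes. -/

theorem convs'Aux_ofStream_succ (f : ℕ → GenContFract.Pair ℝ) (n : ℕ) :
    GenContFract.convs'Aux (Stream'.Seq.ofStream f) (n + 1) =
      (f 0).a / ((f 0).b +
        GenContFract.convs'Aux (Stream'.Seq.ofStream fun i => f (i + 1)) n) := by
  rfl

theorem cfSegment_zero (a b : ℕ → ℝ) (k : ℕ) : cfSegment a b k 0 = a k := by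
  simp [cfSegment, GenContFract.convs', GenContFract.convs'Aux, CF]

theorem cfSegment_succ (a b : ℕ → ℝ) (k n : ℕ) :
    cfSegment a b k (n + 1) = a k + b (k + 1) / cfSegment a b (k + 1) n := by
  simp only [cfSegment, GenContFract.convs', CF, convs'Aux_ofStream_succ, add_zero, zero_add,
    add_assoc, add_comm 1]

theorem convs'_eq_cfSegment (a b : ℕ → ℝ) (n : ℕ) : (CF a b).convs' n = cfSegment a b 0 n := by
  simp [cfSegment]

/-- The terms of the series `∑ 1 / (2 ^ i * i * (i + 1))`, whose sum over `i ≥ 1` is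
`1 - log 2`. -/
noncomputable def logTerm (i : ℕ) : ℝ := 1 / (2 ^ i * i * (i + 1))

theorem logTerm_succ_pos (i : ℕ) : 0 < logTerm (i + 1) := by
  unfold logTerm
  positivity

theorem sum_logTerm_pos (k n : ℕ) : 0 < ∑ i ∈ range (n + 1), logTerm (k + 1 + i) := by
  refine sum_pos (fun i _ => ?_) (by simp)
  rw [add_right_comm]
  exact logTerm_succ_pos _

theorem logTerm_succ_succ (k : ℕ) :
    2 * ((k : ℝ) + 2) * (k + 3) * logTerm (k + 2) = (k + 1) * (k + 2) * logTerm (k + 1) := by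
  unfold logTerm
  push_cast
  field_simp
  ring

/-- Partial fractions at `x = 1/2`: each term is `x^i/i - 2 * x^(i+1)/(i+1)`, a combination of the
series of `log 2` and its shift. -/
theorem hasSum_logTerm : HasSum (fun i => logTerm (i + 1)) (1 - Real.log 2) := by
  have h : HasSum (fun n : ℕ => (1 / 2 : ℝ) ^ (n + 1) / (n + 1)) (Real.log 2) := by
    have := Real.hasSum_pow_div_log_of_abs_lt_one (x := 1 / 2) (by norm_num [abs_of_pos])
    convert this using 1
    rw [show (1 - 1 / 2 : ℝ) = 2⁻¹ by norm_num, Real.log_inv, neg_neg]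
  have h' := (hasSum_nat_add_iff' 1).2 h
  have hvalue : 1 - Real.log 2 = Real.log 2 - 2 * (Real.log 2 -
      ∑ i ∈ range 1, (1 / 2 : ℝ) ^ (i + 1) / (i + 1)) := by
    norm_num
    ring
  rw [hvalue]
  have hterm : (fun i => logTerm (i + 1)) = fun i : ℕ => (1 / 2 : ℝ) ^ (i + 1) / (i + 1) -
      2 * ((1 / 2) ^ (i + 1 + 1) / ((i + 1 : ℕ) + 1)) := by
    funext i
    rw [logTerm, one_div_pow, one_div_pow]
    push_cast
    field_simp
    ring
  rw [hterm]
  exact h.sub (h'.mul_left 2)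

/-- Peeling off the outermost level inverts the ratio for `k + 1`. It closes up because `a (k+1) -
2(k+2)(k+3) = (k+1)(k+2)` and `logTerm_succ_succ` trades the split-off term for its predecessor. -/
theorem cfSegment_eq_sum_div_sum (k n : ℕ) :
    cfSegment (fun n : ℕ => 3 * (n : ℝ) ^ 2 + 7 * (n : ℝ) + 4)
      (fun n : ℕ => -2 * (n : ℝ) ^ 2 * ((n : ℝ) + 1) ^ 2) (k + 1) n =
      ((k : ℝ) + 1) * (k + 2) * (∑ i ∈ range (n + 2), logTerm (k + 1 + i)) /
        ∑ i ∈ range (n + 1), logTerm (k + 2 + i) := by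
  induction n generalizing k with
  | zero =>
    have hk := logTerm_succ_succ k
    have hpos := logTerm_succ_pos (k + 1)
    rw [cfSegment_zero, eq_div_iff (by simpa using hpos.ne')]
    simp only [sum_range_succ, range_zero, sum_empty]
    push_cast
    simp only [zero_add, add_zero, add_assoc, Nat.reduceAdd]
    linear_combination hk
  | succ n ih =>
    have hk := logTerm_succ_succ k
    have hu := sum_logTerm_pos (k + 2) n
    have hv := sum_logTerm_pos (k + 1) (n + 1)
    have e (m l : ℕ) : ∑ i ∈ range (l + 1), logTerm (m + i) =
        logTerm m + ∑ i ∈ range l, logTerm (m + 1 + i) := by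
      rw [sum_range_succ', add_comm]
      simp [add_assoc, add_comm 1]
    rw [cfSegment_succ, ih (k + 1), e (k + 1) (n + 2)]
    simp only [add_assoc, Nat.reduceAdd] at hu hv hk ⊢
    have e' := e (k + 2) (n + 1)
    simp only [add_assoc, Nat.reduceAdd] at e'
    set u := ∑ i ∈ range (n + 1), logTerm (k + (3 + i))
    set v := ∑ i ∈ range (n + 2), logTerm (k + (2 + i))
    push_cast
    field_simp
    rw [e']
    linear_combination ((k : ℝ) + 2) * (k + 3) * hk

theorem cfSegment_zero_eq_inv_sum (n : ℕ) :
    cfSegment (fun n : ℕ => 3 * (n : ℝ) ^ 2 + 7 * (n : ℝ) + 4)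
      (fun n : ℕ => -2 * (n : ℝ) ^ 2 * ((n : ℝ) + 1) ^ 2) 0 n =
      1 / ∑ i ∈ range (n + 1), logTerm (i + 1) := by
  -- Index 0 needs its own computation: the ratio formula would have prefactor `0 * 1` and a block
  -- starting at the singular term `i = 0`.
  cases n with
  | zero => norm_num [cfSegment_zero, logTerm]
  | succ n =>
    have hu := sum_logTerm_pos 1 n
    have hv := sum_logTerm_pos 0 (n + 1)
    rw [cfSegment_succ, cfSegment_eq_sum_div_sum]
    have e : ∑ i ∈ range (n + 2), logTerm (0 + 1 + i) =
        1 / 4 + ∑ i ∈ range (n + 1), logTerm (0 + 2 + i) := by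
      rw [sum_range_succ', add_comm]
      congr 1
      · norm_num [logTerm]
      · exact sum_congr rfl fun i _ => by congr 1; ring
    have e' : ∑ i ∈ range (n + 2), logTerm (i + 1) = ∑ i ∈ range (n + 2), logTerm (0 + 1 + i) :=
      sum_congr rfl fun i _ => by congr 1; ring
    rw [e']
    simp only [zero_add, Nat.reduceAdd] at hu hv e ⊢
    set u := ∑ i ∈ range (n + 1), logTerm (2 + i)
    set v := ∑ i ∈ range (n + 2), logTerm (1 + i)
    push_cast
    field_simp
    rw [e]
    ring

end PolyCF

theorem corollary2p31 :
    PolyCF.HasValue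
      (fun n : ℕ => 3 * (n : ℝ) ^ 2 + 7 * (n : ℝ) + 4)
      (fun n : ℕ => -2 * (n : ℝ) ^ 2 * ((n : ℝ) + 1) ^ 2)
      (1 / (1 - Real.log 2)) := by
  refine ⟨fun k n => ?_, ?_⟩
  · rw [PolyCF.cfSegment_eq_sum_div_sum]
    have h₁ := PolyCF.sum_logTerm_pos k (n + 1)
    have h₂ := PolyCF.sum_logTerm_pos (k + 1) n
    exact (div_pos (mul_pos (by positivity) h₁) h₂).ne'
  · simp only [PolyCF.convs'_eq_cfSegment, PolyCF.cfSegment_zero_eq_inv_sum]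
    have hlog : 1 - Real.log 2 ≠ 0 := by linarith [Real.log_two_lt_d9]
    exact tendsto_const_nhds.div
      (PolyCF.hasSum_logTerm.tendsto_sum_nat.comp (tendsto_add_atTop_nat 1)) hlog
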